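/- Let $H$ be a complex Hilbert space, let $H\hat\otimes_2 H$ be the Hilbertian tensor product (the completion of the algebraic tensor product $H\otimes_{\mathbb C}H$ for the inner product with $\langle u\otimes v,u'\otimes v'\rangle=\langle u,u'\rangle\langle v,v'\rangle$), and let $\mu\colon H\hat\otimes_2 H\to H$ be a bounded linear map with Hilbert adjoint $\mu^\dagger$. Let $\alpha\colon (H\hat\otimes_2 H)\hat\otimes_2 H\to H\hat\otimes_2(H\hat\otimes_2 H)$ and $\sigma\colon H\hat\otimes_2 H\to H\hat\otimes_2 H$ be the canonical unitary associativity and symmetry maps. Assume that $(H,\mu)$ is a commutative Hilbertian Frobenius semigroup, that is, $\mu\circ(\mu\hat\otimes_2 \mathrm{id})=\mu\circ(\mathrm{id}\hat\otimes_2\mu)\circ\alpha$, $\mu\circ\sigma=\mu$, and $$(\mu\hat\otimes_2\mathrm{id})\circ\alpha^{-1}\circ(\mathrm{id}\hat\otimes_2\mu^\dagger)=\mu^\dagger\circ\mu=(\mathrm{id}\hat\otimes_2\mu)\circ\alpha\circ(\mu^\dagger\hat\otimes_2\mathrm{id}).$$ Write $uv=\mu(u\otimes v)$, and let $M\colon H\to\mathcal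 B(H)$, $M_u(v)=uv$, be the regular representation. The Jacobson radical of $(H,\mu)$ is the intersection of all maximal modular left ideals of the (not necessarily unital) algebra $H$ with product $uv$ (all of $H$ if there are none), and $(H,\mu)$ is semisimple if its Jacobson radical is $(0)$. Then the following assertions are equivalent. 1. $(H,\mu)$ is semisimple. 2. $(H,\mu)$ is faithful, that is, $\ker M=(0)$. 3. $\mu$ has a dense range. 4. $\mu^\dagger$ is one-to-one. 5. $\mu\circ\mu^\dagger$ is one-to-one. In particular, if $(H,\mu)$ is moreover special, that is, $\mu\circ\mu^\dagger=\mathrm{id}_H$, then $(H,\mu)$ is semisimple. -/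

import Mathlib

open scoped TensorProduct

noncomputable section

namespace HilbertianFrobenius

open UniformSpace

/-! ### The Hilbertian tensor product -/

/-- The Hilbertian tensor product of two Hilbert spaces: the completion of the algebraic tensor
product for the inner product determined by `⟪x ⊗ y, x' ⊗ y'⟫ = ⟪x, x'⟫ * ⟪y, y'⟫`. -/
def HTensor (H K : Type*) [NormedAddCommGroup H] [InnerProductSpace ℂ H]
    [NormedAddCommGroup K] [InnerProductSpace ℂ K] : Type _ :=
  Completion (H ⊗[ℂ] K)

section Tensor

variable {H K L H' K' : Type*}
  [NormedAddCommGroup H] [InnerProductSpace ℂ H]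
  [NormedAddCommGroup K] [InnerProductSpace ℂ K]
  [NormedAddCommGroup L] [InnerProductSpace ℂ L]
  [NormedAddCommGroup H'] [InnerProductSpace ℂ H']
  [NormedAddCommGroup K'] [InnerProductSpace ℂ K']

instance : NormedAddCommGroup (HTensor H K) :=
  inferInstanceAs (NormedAddCommGroup (Completion (H ⊗[ℂ] K)))

instance : InnerProductSpace ℂ (HTensor H K) :=
  inferInstanceAs (InnerProductSpace ℂ (Completion (H ⊗[ℂ] K)))

instance : CompleteSpace (HTensor H K) :=
  inferInstanceAs (CompleteSpace (Completion (H ⊗[ℂ] K)))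

variable (H K) in
/-- The isometric inclusion of the algebraic tensor product in its completion. -/
def incl : (H ⊗[ℂ] K) →ₗᵢ[ℂ] HTensor H K :=
  (Completion.toComplₗᵢ : (H ⊗[ℂ] K) →ₗᵢ[ℂ] Completion (H ⊗[ℂ] K))

theorem denseRange_incl : DenseRange (incl H K) :=
  Completion.denseRange_coe

variable (H K) in
/-- The canonical bounded bilinear map sending `x`, `y` to the elementary tensor `x ⊗ y` of the
Hilbertian tensor product. -/
def tmulL : H →L[ℂ] K →L[ℂ] HTensor H K :=
  (incl H K).toContinuousLinearMap.postcomp K ∘L TensorProduct.mkL ℂ H K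

theorem tmulL_apply (x : H) (y : K) : tmulL H K x y = incl H K (x ⊗ₜ[ℂ] y) := rfl

/-- The Hilbertian tensor product of two bounded linear maps. -/
def hmap (f : H →L[ℂ] H') (g : K →L[ℂ] K') : HTensor H K →L[ℂ] HTensor H' K' :=
  ((incl H' K').toContinuousLinearMap ∘L TensorProduct.mapL f g).extend
    (incl H K).toContinuousLinearMap

theorem hmap_tmulL (f : H →L[ℂ] H') (g : K →L[ℂ] K') (x : H) (y : K) :
    hmap f g (tmulL H K x y) = tmulL H' K' (f x) (g y) :=
  ContinuousLinearMap.extend_eq (e := (incl H K).toContinuousLinearMap) _ denseRange_incl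
    (incl H K).isometry.isUniformInducing (x ⊗ₜ y)

variable (H K) in
/-- The symmetry constraint, the unitary map sending `x ⊗ y` to `y ⊗ x`. -/
def symmetry : HTensor H K ≃ₗᵢ[ℂ] HTensor K H :=
  (TensorProduct.commIsometry ℂ H K).toLinearEquiv.extendOfIsometry
    (incl H K).toLinearMap (incl K H).toLinearMap denseRange_incl denseRange_incl
    (fun x ↦ ((incl K H).norm_map _).trans
      ((LinearIsometryEquiv.norm_map _ x).trans ((incl H K).norm_map x).symm))

theorem symmetry_tmulL (x : H) (y : K) : symmetry H K (tmulL H K x y) = tmulL K H y x :=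
  LinearEquiv.extendOfIsometry_eq (TensorProduct.commIsometry ℂ H K).toLinearEquiv
    (incl H K).toLinearMap (incl K H).toLinearMap denseRange_incl denseRange_incl _ (x ⊗ₜ y)

variable (H K L) in
/-- The isometric inclusion of the algebraic tensor product `(H ⊗ K) ⊗ L` in the Hilbertian one. -/
def inclLeft : ((H ⊗[ℂ] K) ⊗[ℂ] L) →ₗᵢ[ℂ] HTensor (HTensor H K) L :=
  (incl (HTensor H K) L).comp ((incl H K).rTensor L)

variable (H K L) in
/-- The isometric inclusion of the algebraic tensor product `H ⊗ (K ⊗ L)` in the Hilbertian one. -/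
def inclRight : (H ⊗[ℂ] (K ⊗[ℂ] L)) →ₗᵢ[ℂ] HTensor H (HTensor K L) :=
  (incl H (HTensor K L)).comp ((incl K L).lTensor H)

theorem inclLeft_tmul (t : H ⊗[ℂ] K) (z : L) :
    inclLeft H K L (t ⊗ₜ z) = tmulL (HTensor H K) L (incl H K t) z := by
  rw [tmulL_apply]
  exact congrArg (incl (HTensor H K) L) (LinearMap.rTensor_tmul L (incl H K).toLinearMap z t)

theorem inclRight_tmul (x : H) (t : K ⊗[ℂ] L) :
    inclRight H K L (x ⊗ₜ t) = tmulL H (HTensor K L) x (incl K L t) := by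
  rw [tmulL_apply]
  exact congrArg (incl H (HTensor K L)) (LinearMap.lTensor_tmul H (incl K L).toLinearMap x t)

theorem denseRange_of_tmulL_mem {E : Type*} [AddCommGroup E] [Module ℂ E]
    (e : E →ₗ[ℂ] HTensor H K)
    (h : ∀ x y, tmulL H K x y ∈ (LinearMap.range e).topologicalClosure) :
    DenseRange e := by
  have key : ∀ t : H ⊗[ℂ] K,
      incl H K t ∈ (LinearMap.range e).topologicalClosure := by
    intro t
    induction t using TensorProduct.induction_on with
    | zero => rw [map_zero]; exact zero_mem _
    | tmul x y => exact h x y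
    | add a b ha hb => rw [map_add]; exact add_mem ha hb
  intro z
  have hz : z ∈ (LinearMap.range e).topologicalClosure :=
    denseRange_incl.induction_on (p := fun z ↦
      z ∈ (LinearMap.range e).topologicalClosure) z
      (Submodule.isClosed_topologicalClosure _) key
  rwa [← SetLike.mem_coe, Submodule.topologicalClosure_coe, LinearMap.coe_range] at hz

theorem denseRange_inclLeft : DenseRange (inclLeft H K L).toLinearMap := by
  refine denseRange_of_tmulL_mem (inclLeft H K L).toLinearMap fun t z ↦ ?_
  set S := (LinearMap.range (inclLeft H K L).toLinearMap).topologicalClosure with hS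
  have hc : IsClosed {t | tmulL (HTensor H K) L t z ∈ S} :=
    IsClosed.preimage ((tmulL (HTensor H K) L).flip z).continuous
      (Submodule.isClosed_topologicalClosure _)
  refine (denseRange_incl (H := H) (K := K)).induction_on t hc fun a ↦ ?_
  change tmulL (HTensor H K) L (incl H K a) z ∈ S
  rw [← inclLeft_tmul]
  exact Submodule.le_topologicalClosure _ (LinearMap.mem_range_self _ _)

theorem denseRange_inclRight : DenseRange (inclRight H K L).toLinearMap := by
  refine denseRange_of_tmulL_mem (inclRight H K L).toLinearMap fun x t ↦ ?_
  set S := (LinearMap.range (inclRight H K L).toLinearMap).topologicalClosure with hS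
  have hc : IsClosed {t | tmulL H (HTensor K L) x t ∈ S} :=
    IsClosed.preimage (tmulL H (HTensor K L) x).continuous
      (Submodule.isClosed_topologicalClosure _)
  refine (denseRange_incl (H := K) (K := L)).induction_on t hc fun a ↦ ?_
  change tmulL H (HTensor K L) x (incl K L a) ∈ S
  rw [← inclRight_tmul]
  exact Submodule.le_topologicalClosure _ (LinearMap.mem_range_self _ _)

variable (H K L) in
/-- The associativity constraint, the unitary map sending `(x ⊗ y) ⊗ z` to `x ⊗ (y ⊗ z)`. -/
def associator : HTensor (HTensor H K) L ≃ₗᵢ[ℂ] HTensor H (HTensor K L) :=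
  (TensorProduct.assocIsometry ℂ H K L).toLinearEquiv.extendOfIsometry
    (inclLeft H K L).toLinearMap (inclRight H K L).toLinearMap
    denseRange_inclLeft denseRange_inclRight
    (fun x ↦ ((inclRight H K L).norm_map _).trans
      (((TensorProduct.assocIsometry ℂ H K L).norm_map x).trans
        ((inclLeft H K L).norm_map x).symm))

theorem associator_tmulL (x : H) (y : K) (z : L) :
    associator H K L (tmulL (HTensor H K) L (tmulL H K x y) z) =
      tmulL H (HTensor K L) x (tmulL K L y z) := by
  have h : associator H K L (inclLeft H K L ((x ⊗ₜ y) ⊗ₜ z)) =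
      inclRight H K L (x ⊗ₜ (y ⊗ₜ z)) :=
    LinearEquiv.extendOfIsometry_eq (TensorProduct.assocIsometry ℂ H K L).toLinearEquiv
      (inclLeft H K L).toLinearMap (inclRight H K L).toLinearMap
      denseRange_inclLeft denseRange_inclRight _ _
  rwa [inclLeft_tmul, inclRight_tmul] at h

end Tensor

/-! ### The Jacobson radical of a not necessarily unital algebra

An algebra is a complex vector space `A` with a bilinear multiplication
`m : A →ₗ[ℂ] A →ₗ[ℂ] A`; associativity is a separate assumption where it is needed. -/

section Jacobson

variable {A : Type*} [AddCommGroup A] [Module ℂ A]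

/-- `I` is a left ideal of the algebra `(A, m)`. -/
def IsLeftIdeal (m : A →ₗ[ℂ] A →ₗ[ℂ] A) (I : Submodule ℂ A) : Prop :=
  ∀ a x : A, x ∈ I → m a x ∈ I

/-- `I` is a modular left ideal of `(A, m)`: there is an `e` such that `a - a e ∈ I` for all `a`. -/
def IsModularLeftIdeal (m : A →ₗ[ℂ] A →ₗ[ℂ] A) (I : Submodule ℂ A) : Prop :=
  IsLeftIdeal m I ∧ ∃ e : A, ∀ a : A, a - m a e ∈ I

/-- `I` is a maximal modular left ideal of `(A, m)`: a modular left ideal that is maximal among the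
proper left ideals. -/
def IsMaximalModularLeftIdeal (m : A →ₗ[ℂ] A →ₗ[ℂ] A) (I : Submodule ℂ A) : Prop :=
  IsModularLeftIdeal m I ∧ I ≠ ⊤ ∧ ∀ I' : Submodule ℂ A, IsLeftIdeal m I' → I < I' → I' = ⊤

/-- The Jacobson radical of `(A, m)`: the intersection of all its maximal modular left ideals (the
whole of `A` if there are none). -/
def jacobsonRadical (m : A →ₗ[ℂ] A →ₗ[ℂ] A) : Submodule ℂ A :=
  sInf {I | IsMaximalModularLeftIdeal m I}

end Jacobson

/-! ### Hilbertian Frobenius semigroups -/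

section Frobenius

variable {H : Type*} [NormedAddCommGroup H] [InnerProductSpace ℂ H]

/-- The regular representation `M` of `(H, μ)`: `M u v = μ (u ⊗ v)`. It is also the bounded
bilinear multiplication associated with `μ`. -/
def regularRep (μ : HTensor H H →L[ℂ] H) : H →L[ℂ] H →L[ℂ] H :=
  μ.postcomp H ∘L tmulL H H

theorem regularRep_apply (μ : HTensor H H →L[ℂ] H) (u v : H) :
    regularRep μ u v = μ (tmulL H H u v) := rfl

/-- `(H, μ)` is semisimple: the Jacobson radical of its underlying algebra is zero. -/
def IsSemisimple (μ : HTensor H H →L[ℂ] H) : Prop :=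
  jacobsonRadical (regularRep μ).toLinearMap₁₂ = ⊥

/-- `(H, μ)` is a commutative semigroup object in the symmetric monoidal category of Hilbert
spaces and bounded linear maps. -/
structure IsCommSemigroup (μ : HTensor H H →L[ℂ] H) : Prop where
  assoc : μ ∘L hmap μ (.id ℂ H) =
    μ ∘L hmap (.id ℂ H) μ ∘L (associator H H H : _ →L[ℂ] HTensor H (HTensor H H))
  comm : μ ∘L (symmetry H H : HTensor H H →L[ℂ] HTensor H H) = μ

variable [CompleteSpace H]

/-- The Frobenius condition: the Hilbert adjoint of `μ` is a morphism of left modules and of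
right modules, that is, `(μ ⊗ id) α⁻¹ (id ⊗ μ†) = μ† μ = (id ⊗ μ) α (μ† ⊗ id)`. -/
structure IsFrobenius (μ : HTensor H H →L[ℂ] H) : Prop where
  left : hmap μ (.id ℂ H) ∘L
      ((associator H H H).symm : _ →L[ℂ] HTensor (HTensor H H) H) ∘L
      hmap (.id ℂ H) μ.adjoint = μ.adjoint ∘L μ
  right : hmap (.id ℂ H) μ ∘L
      (associator H H H : _ →L[ℂ] HTensor H (HTensor H H)) ∘L
      hmap μ.adjoint (.id ℂ H) = μ.adjoint ∘L μ

/-- `(H, μ)` is a commutative Hilbertian Frobenius semigroup. -/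
structure IsCommFrobeniusSemigroup (μ : HTensor H H →L[ℂ] H) : Prop
    extends IsCommSemigroup μ, IsFrobenius μ

/-- `(H, μ)` is special: its multiplication is coisometric. -/
def IsSpecial (μ : HTensor H H →L[ℂ] H) : Prop :=
  μ ∘L μ.adjoint = .id ℂ H

end Frobenius

end HilbertianFrobenius

end

/-! Everything is read off from kernels: `ker μ†` is the orthogonal complement of the range of `μ`
and equals `ker (μ μ†)`, and it is to be identified with `ker M` and with the Jacobson radical.

The Frobenius condition says that `μ†` is `H`-linear, so that `M_u†` commutes with multiplication
by the elements of `H`; in particular every `M_u` is normal, and `M_v† u = 0` iff `v u = 0`. As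
`⟪μ† u, v ⊗ w⟫ = ⟪M_v† u, w⟫`, this gives `ker μ† = ker M`.

An element `x` of the radical is quasi-regular, as are its multiples, so that the operator of right
multiplication by `x` has no nonzero spectral value. When this operator is `M_x`, which is normal,
it vanishes; hence the radical is contained in `ker M`, and the converse inclusion holds in every
algebra. -/

namespace HilbertianFrobenius

section Tensor

variable {H K L H' K' : Type*}
  [NormedAddCommGroup H] [InnerProductSpace ℂ H]
  [NormedAddCommGroup K] [InnerProductSpace ℂ K]
  [NormedAddCommGroup L] [InnerProductSpace ℂ L]
  [NormedAddCommGroup H'] [InnerProductSpace ℂ H']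
  [NormedAddCommGroup K'] [InnerProductSpace ℂ K']

theorem HTensor.hom_ext {E : Type*} [AddCommMonoid E] [Module ℂ E] [TopologicalSpace E] [T2Space E]
    {f g : HTensor H K →L[ℂ] E} (h : ∀ x y, f (tmulL H K x y) = g (tmulL H K x y)) : f = g := by
  have h_incl : f.toLinearMap ∘ₗ (incl H K).toLinearMap = g.toLinearMap ∘ₗ (incl H K).toLinearMap :=
    TensorProduct.ext' h
  exact DFunLike.coe_injective
    (denseRange_incl.equalizer f.continuous g.continuous (funext (LinearMap.congr_fun h_incl)))

theorem inner_tmulL_tmulL (x x' : H) (y y' : K) :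
    inner ℂ (tmulL H K x y) (tmulL H K x' y') = inner ℂ x x' * inner ℂ y y' := by
  rw [tmulL_apply, tmulL_apply, LinearIsometry.inner_map_map, TensorProduct.inner_tmul]

theorem HTensor.ext_inner_tmulL {s t : HTensor H K}
    (h : ∀ x y, inner ℂ s (tmulL H K x y) = inner ℂ t (tmulL H K x y)) : s = t :=
  (innerSL_inj (𝕜 := ℂ)).mp (HTensor.hom_ext h)

theorem adjoint_hmap [CompleteSpace H] [CompleteSpace K] [CompleteSpace H'] [CompleteSpace K']
    (f : H →L[ℂ] H') (g : K →L[ℂ] K') : (hmap f g).adjoint = hmap f.adjoint g.adjoint := by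
  refine HTensor.hom_ext fun x' y' ↦ HTensor.ext_inner_tmulL fun x y ↦ ?_
  simp only [ContinuousLinearMap.adjoint_inner_left, hmap_tmulL, inner_tmulL_tmulL]

theorem inner_adjoint_tmulL [CompleteSpace K] [CompleteSpace L] (f : HTensor H K →L[ℂ] L) (u : L)
    (x : H) (y : K) :
    inner ℂ (f.adjoint u) (tmulL H K x y) = inner ℂ ((f ∘L tmulL H K x).adjoint u) y := by
  rw [ContinuousLinearMap.adjoint_inner_left, ContinuousLinearMap.adjoint_inner_left,
    ContinuousLinearMap.comp_apply]

theorem adjoint_eq_zero_iff_forall_adjoint_comp_tmulL [CompleteSpace K] [CompleteSpace L]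
    {f : HTensor H K →L[ℂ] L} {u : L} :
    f.adjoint u = 0 ↔ ∀ x, (f ∘L tmulL H K x).adjoint u = 0 := by
  refine ⟨fun h x ↦ ext_inner_right ℂ fun y ↦ ?_, fun h ↦ HTensor.ext_inner_tmulL fun x y ↦ ?_⟩
  · rw [← inner_adjoint_tmulL, h, inner_zero_left, inner_zero_left]
  · rw [inner_adjoint_tmulL, h, inner_zero_left, inner_zero_left]

theorem hmap_associator_symm_tmulL (f : HTensor H K →L[ℂ] H') (g : L →L[ℂ] K') (x : H)
    (t : HTensor K L) :
    hmap f g ((associator H K L).symm (tmulL H (HTensor K L) x t)) =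
      hmap (f ∘L tmulL H K x) g t := by
  have h_comp : hmap f g ∘L ((associator H K L).symm : _ →L[ℂ] HTensor (HTensor H K) L) ∘L
      tmulL H (HTensor K L) x = hmap (f ∘L tmulL H K x) g := by
    refine HTensor.hom_ext fun y z ↦ ?_
    change hmap f g ((associator H K L).symm (tmulL H _ x (tmulL K L y z))) = _
    rw [← associator_tmulL, LinearIsometryEquiv.symm_apply_apply, hmap_tmulL, hmap_tmulL,
      ContinuousLinearMap.comp_apply]
  exact DFunLike.congr_fun h_comp t

end Tensor

section Jacobson

variable {A : Type*} [AddCommGroup A] [Module ℂ A] {m : A →ₗ[ℂ] A →ₗ[ℂ] A}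

theorem IsLeftIdeal.eq_top_of_mem {I : Submodule ℂ A} (hI : IsLeftIdeal m I) {e : A}
    (he : ∀ a, a - m a e ∈ I) (heI : e ∈ I) : I = ⊤ :=
  Submodule.eq_top_iff'.mpr fun a ↦ (I.sub_mem_iff_left (hI a e heI)).mp (he a)

theorem IsLeftIdeal.sSup_of_directedOn {c : Set (Submodule ℂ A)} (hne : c.Nonempty)
    (hdir : DirectedOn (· ≤ ·) c) (hc : ∀ I ∈ c, IsLeftIdeal m I) : IsLeftIdeal m (sSup c) := by
  intro a x hx
  obtain ⟨I, hI, hxI⟩ := (Submodule.mem_sSup_of_directed hne hdir).mp hx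
  exact Submodule.mem_sSup_of_mem hI (hc I hI a x hxI)

theorem IsLeftIdeal.exists_maximal_notMem {I : Submodule ℂ A} (hI : IsLeftIdeal m I) {e : A}
    (heI : e ∉ I) :
    ∃ J, I ≤ J ∧ Maximal (fun J ↦ IsLeftIdeal m J ∧ e ∉ J) J := by
  refine zorn_le_nonempty₀ {J | IsLeftIdeal m J ∧ e ∉ J} (fun c hc hchain J hJ ↦ ?_) I ⟨hI, heI⟩
  have hdir := hchain.directedOn
  refine ⟨sSup c, ⟨.sSup_of_directedOn ⟨J, hJ⟩ hdir fun K hK ↦ (hc hK).1, fun he ↦ ?_⟩,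
    fun K hK ↦ le_sSup hK⟩
  obtain ⟨K, hK, heK⟩ := (Submodule.mem_sSup_of_directed ⟨J, hJ⟩ hdir).mp he
  exact (hc hK).2 heK

theorem IsLeftIdeal.exists_isMaximalModularLeftIdeal_notMem {I : Submodule ℂ A}
    (hI : IsLeftIdeal m I) {e : A} (he : ∀ a, a - m a e ∈ I) (hne : I ≠ ⊤) :
    ∃ J, IsMaximalModularLeftIdeal m J ∧ e ∉ J := by
  -- A left ideal containing all `a - m a e` is proper iff it avoids `e`, so that maximality among
  -- the left ideals avoiding `e` is maximality among the proper ones.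
  obtain ⟨J, hIJ, hJ⟩ := hI.exists_maximal_notMem fun heI ↦ hne (hI.eq_top_of_mem he heI)
  obtain ⟨hJideal, heJ⟩ := hJ.prop
  refine ⟨J, ⟨⟨hJideal, e, fun a ↦ hIJ (he a)⟩, fun hJtop ↦ heJ (hJtop ▸ Submodule.mem_top),
    fun K hK hJK ↦ ?_⟩, heJ⟩
  have heK : e ∈ K := by
    by_contra heK
    exact hJ.not_prop_of_gt hJK ⟨hK, heK⟩
  exact hK.eq_top_of_mem (fun a ↦ hJK.le (hIJ (he a))) heK

theorem isLeftIdeal_jacobsonRadical : IsLeftIdeal m (jacobsonRadical m) := fun a x hx ↦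
  Submodule.mem_sInf.mpr fun I hI ↦ hI.1.1 a x (Submodule.mem_sInf.mp hx I hI)

theorem ker_le_jacobsonRadical : m.ker ≤ jacobsonRadical m := by
  refine fun u hu ↦ Submodule.mem_sInf.mpr fun I hI ↦ ?_
  obtain ⟨⟨-, e, he⟩, -⟩ := hI
  simpa [LinearMap.mem_ker.mp hu] using he u

theorem exists_sub_mul_eq_of_mem_jacobsonRadical (assoc : ∀ a b c, m (m a b) c = m a (m b c))
    {x : A} (hx : x ∈ jacobsonRadical m) (b : A) : ∃ a, a - m a x = b := by
  let I : Submodule ℂ A := (LinearMap.id - m.flip x).range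
  have hI : IsLeftIdeal m I := by
    rintro a _ ⟨c, rfl⟩
    exact ⟨m a c, by simp [assoc]⟩
  have hItop : I = ⊤ := by
    by_contra hne
    obtain ⟨J, hJ, hxJ⟩ := hI.exists_isMaximalModularLeftIdeal_notMem (fun a ↦ ⟨a, rfl⟩) hne
    exact hxJ (Submodule.mem_sInf.mp hx J hJ)
  exact (hItop ▸ Submodule.mem_top : b ∈ I)

theorem isUnit_one_sub_flip_of_mem_jacobsonRadical
    (assoc : ∀ a b c, m (m a b) c = m a (m b c)) {x : A} (hx : x ∈ jacobsonRadical m) :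
    IsUnit (1 - m.flip x : Module.End ℂ A) := by
  -- A left quasi-inverse of `x` is itself in the radical, so that it has a left quasi-inverse too;
  -- as in a monoid, the latter must be `x`.
  have exists_quasiInverse {z : A} (hz : z ∈ jacobsonRadical m) : ∃ y ∈ jacobsonRadical m,
      (1 - m.flip z : Module.End ℂ A) * (1 - m.flip y) = 1 := by
    obtain ⟨y, hy⟩ := exists_sub_mul_eq_of_mem_jacobsonRadical assoc hz (-z)
    have hyz : m y z = y + z := (eq_add_neg_iff_add_eq.mp (sub_eq_iff_eq_add'.mp hy)).symm
    refine ⟨y, (add_mem_cancel_right hz).mp (hyz ▸ isLeftIdeal_jacobsonRadical y z hz),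
      LinearMap.ext fun a ↦ ?_⟩
    calc (a - m a y) - m (a - m a y) z
        = a - m a y - m a z + m a (m y z) := by rw [map_sub, LinearMap.sub_apply, assoc]; abel
      _ = a := by rw [hyz, map_add]; abel
  obtain ⟨y, hy, hxy⟩ := exists_quasiInverse hx
  obtain ⟨z, -, hyz⟩ := exists_quasiInverse hy
  have hxz := left_inv_eq_right_inv hxy hyz
  exact ⟨⟨_, _, hxy, hxz ▸ hyz⟩, rfl⟩

theorem spectrum_flip_subset_zero_of_mem_jacobsonRadical
    (assoc : ∀ a b c, m (m a b) c = m a (m b c)) {x : A} (hx : x ∈ jacobsonRadical m) :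
    spectrum ℂ (m.flip x : Module.End ℂ A) ⊆ {0} := by
  intro k hk
  by_contra hk0
  have hunit := isUnit_one_sub_flip_of_mem_jacobsonRadical assoc (Submodule.smul_mem _ k⁻¹ hx)
  have hsub : (1 - k⁻¹ • m.flip x : Module.End ℂ A) = 1 - m.flip (k⁻¹ • x) := by rw [map_smul]
  rw [spectrum.mem_iff, Algebra.algebraMap_eq_smul_one] at hk
  exact hk ((IsUnit.smul_sub_iff_sub_inv_smul (Units.mk0 k hk0) _).mpr (hsub ▸ hunit))

end Jacobson

section Frobenius

variable {H : Type*} [NormedAddCommGroup H] [InnerProductSpace ℂ H] {μ : HTensor H H →L[ℂ] H}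

theorem IsCommSemigroup.mul_comm (hμ : IsCommSemigroup μ) (u v : H) :
    regularRep μ u v = regularRep μ v u := by
  have h := DFunLike.congr_fun hμ.comm (tmulL H H v u)
  rwa [ContinuousLinearMap.comp_apply, LinearIsometryEquiv.coe_coe'', symmetry_tmulL] at h

theorem IsCommSemigroup.mul_assoc (hμ : IsCommSemigroup μ) (u v w : H) :
    regularRep μ (regularRep μ u v) w = regularRep μ u (regularRep μ v w) := by
  have h := DFunLike.congr_fun hμ.assoc (tmulL _ _ (tmulL H H u v) w)
  change μ (hmap μ (.id ℂ H) _) = μ (hmap (.id ℂ H) μ (associator H H H _)) at h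
  rwa [associator_tmulL, hmap_tmulL, hmap_tmulL] at h

variable [CompleteSpace H]

theorem IsFrobenius.adjoint_comp_regularRep (hμ : IsFrobenius μ) (u : H) :
    μ.adjoint ∘L regularRep μ u = hmap (regularRep μ u) (.id ℂ H) ∘L μ.adjoint := by
  ext v
  have h := DFunLike.congr_fun hμ.left (tmulL H H u v)
  change hmap μ (.id ℂ H) ((associator H H H).symm (hmap (.id ℂ H) μ.adjoint _)) = _ at h
  rw [hmap_tmulL, hmap_associator_symm_tmulL] at h
  exact h.symm

theorem IsFrobenius.adjoint_regularRep_comp (hμ : IsFrobenius μ) (u : H) :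
    (regularRep μ u).adjoint ∘L μ = μ ∘L hmap (regularRep μ u).adjoint (.id ℂ H) := by
  have h := congrArg ContinuousLinearMap.adjoint (hμ.adjoint_comp_regularRep u)
  simpa only [ContinuousLinearMap.adjoint_comp, ContinuousLinearMap.adjoint_adjoint, adjoint_hmap,
    ContinuousLinearMap.adjoint_id] using h

theorem IsFrobenius.adjoint_regularRep_mul (hμ : IsFrobenius μ) (u x y : H) :
    (regularRep μ u).adjoint (regularRep μ x y) =
      regularRep μ ((regularRep μ u).adjoint x) y := by
  have h := DFunLike.congr_fun (hμ.adjoint_regularRep_comp u) (tmulL H H x y)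
  rwa [ContinuousLinearMap.comp_apply, ContinuousLinearMap.comp_apply, hmap_tmulL] at h

theorem IsCommFrobeniusSemigroup.isStarNormal_regularRep (hμ : IsCommFrobeniusSemigroup μ) (u : H) :
    IsStarNormal (regularRep μ u) := by
  refine ⟨ContinuousLinearMap.ext fun x ↦ ?_⟩
  calc (regularRep μ u).adjoint (regularRep μ u x)
      = (regularRep μ u).adjoint (regularRep μ x u) := by rw [hμ.mul_comm]
    _ = regularRep μ ((regularRep μ u).adjoint x) u := hμ.adjoint_regularRep_mul u x u
    _ = regularRep μ u ((regularRep μ u).adjoint x) := hμ.mul_comm _ _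

theorem IsCommFrobeniusSemigroup.ker_regularRep (hμ : IsCommFrobeniusSemigroup μ) :
    (regularRep μ).ker = μ.adjoint.ker := by
  ext u
  have hker (v : H) : (regularRep μ v).adjoint u = 0 ↔ regularRep μ v u = 0 :=
    ContinuousLinearMap.IsStarNormal.adjoint_apply_eq_zero_iff (hμ.isStarNormal_regularRep v) u
  calc regularRep μ u = 0
      ↔ ∀ v, regularRep μ u v = 0 := ContinuousLinearMap.ext_iff
    _ ↔ ∀ v, (regularRep μ v).adjoint u = 0 :=
      forall_congr' fun v ↦ by rw [hker, hμ.mul_comm]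
    _ ↔ μ.adjoint u = 0 := adjoint_eq_zero_iff_forall_adjoint_comp_tmulL.symm

theorem IsCommFrobeniusSemigroup.jacobsonRadical_eq_ker (hμ : IsCommFrobeniusSemigroup μ) :
    jacobsonRadical (regularRep μ).toLinearMap₁₂ = (regularRep μ).ker := by
  refine le_antisymm (fun x hx ↦ ?_) fun x hx ↦ ker_le_jacobsonRadical ?_
  · have hflip : (regularRep μ).toLinearMap₁₂.flip x = (regularRep μ x).toLinearMap :=
      LinearMap.ext fun a ↦ hμ.mul_comm a x
    have hspec : spectrum ℂ (regularRep μ x) ⊆ {0} := by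
      rw [ContinuousLinearMap.spectrum_eq, ← hflip]
      exact spectrum_flip_subset_zero_of_mem_jacobsonRadical hμ.mul_assoc hx
    exact CFC.eq_zero_of_spectrum_subset_zero _ hspec (hμ.isStarNormal_regularRep x)
  · exact LinearMap.ext (ContinuousLinearMap.ext_iff.mp hx)

end Frobenius

theorem denseRange_iff_injective_adjoint {𝕜 E F : Type*} [RCLike 𝕜]
    [NormedAddCommGroup E] [InnerProductSpace 𝕜 E] [CompleteSpace E]
    [NormedAddCommGroup F] [InnerProductSpace 𝕜 F] [CompleteSpace F] (T : E →L[𝕜] F) :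
    DenseRange T ↔ Function.Injective T.adjoint := by
  have hdense : DenseRange T ↔ T.range.topologicalClosure = ⊤ :=
    Submodule.dense_iff_topologicalClosure_eq_top (s := T.range)
  rw [hdense, Submodule.topologicalClosure_eq_top_iff, ContinuousLinearMap.orthogonal_range,
    LinearMap.ker_eq_bot, ContinuousLinearMap.coe_coe]

end HilbertianFrobenius

theorem mainTheorem3 {H : Type*} [NormedAddCommGroup H] [InnerProductSpace ℂ H] [CompleteSpace H]
    (μ : HilbertianFrobenius.HTensor H H →L[ℂ] H)
    (hμ : HilbertianFrobenius.IsCommFrobeniusSemigroup μ) :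
    List.TFAE [
      HilbertianFrobenius.IsSemisimple μ,
      (HilbertianFrobenius.regularRep μ).ker = ⊥,
      DenseRange μ,
      Function.Injective μ.adjoint,
      Function.Injective (μ ∘L μ.adjoint)] ∧
    (HilbertianFrobenius.IsSpecial μ → HilbertianFrobenius.IsSemisimple μ) := by
  have semisimple_iff_faithful :
      HilbertianFrobenius.IsSemisimple μ ↔ (HilbertianFrobenius.regularRep μ).ker = ⊥ := by
    rw [HilbertianFrobenius.IsSemisimple, hμ.jacobsonRadical_eq_ker]
  have faithful_iff_injective :
      (HilbertianFrobenius.regularRep μ).ker = ⊥ ↔ Function.Injective μ.adjoint := by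
    rw [hμ.ker_regularRep, LinearMap.ker_eq_bot, ContinuousLinearMap.coe_coe]
  have dense_iff_injective := HilbertianFrobenius.denseRange_iff_injective_adjoint μ
  have comp_injective_iff : Function.Injective (μ ∘L μ.adjoint) ↔ Function.Injective μ.adjoint :=
    μ.self_comp_adjoint_injective_iff
  refine ⟨?_, fun hspecial ↦
    semisimple_iff_faithful.mpr (faithful_iff_injective.mpr (comp_injective_iff.mp ?_))⟩
  · tfae_have 1 ↔ 2 := semisimple_iff_faithful
    tfae_have 2 ↔ 4 := faithful_iff_injective
    tfae_have 3 ↔ 4 := dense_iff_injective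
    tfae_have 5 ↔ 4 := comp_injective_iff
    tfae_finish
  · rw [show μ ∘L μ.adjoint = .id ℂ H from hspecial]
    exact Function.injective_id
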